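/- For $n\ge 0$ let $q_n=x_1^2+\dots+x_n^2\in\mathbb{C}[x_1,\dots,x_n]$. For a form $f\in\mathbb{C}[x_1,\dots,x_n]$ of degree $d$, a Waring decomposition of $f$ of size $r$ is an expression $f=l_1^d+\dots+l_r^d$ with $r$ distinct linear forms $l_1,\dots,l_r\in\mathbb{C}[x_1,\dots,x_n]$, and the Waring rank $\operatorname{rk} f$ is the least size of a Waring decomposition of $f$. For integers $k,s\ge 0$ let $p_k(s)$ be the number of partitions of $s$ into exactly $k$ positive parts. For all integers $n\ge 0$ and $s\ge 1$, the form $q_n^s$ of degree $2s$ has a Waring decomposition, and $$\operatorname{rk}(q_n^s)\;\le\; 2^{s-1}\binom{n}{s}+2^{s-2}\binom{n}{s-1}+\sum_{k=1}^{s-2}2^{k-1}\,k!\,p_k(s)\binom{n}{k},$$ where the sum is empty for $s\le 2$. Moreover, for every fixed integer $s\ge 0$, $\operatorname{rk}(q_n^s)=O(n^s)$ as $n\to\infty$. -/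

import Mathlib

open Filter Asymptotics

/-- The quadratic form `q_n = x_1² + ⋯ + x_n²` over `ℂ`. -/
noncomputable def quadricForm (n : ℕ) : MvPolynomial (Fin n) ℂ :=
  ∑ i : Fin n, MvPolynomial.X i ^ 2

/-- `L` is a Waring decomposition of `f`, seen as a form of degree `d`: a finite set of (pairwise
different) linear forms the sum of whose `d`-th powers is `f`. Its size is `L.card`. -/
def IsWaringDecomposition {n : ℕ} (d : ℕ) (f : MvPolynomial (Fin n) ℂ)
    (L : Finset (MvPolynomial (Fin n) ℂ)) : Prop :=
  (∀ l ∈ L, l.IsHomogeneous 1) ∧ f = ∑ l ∈ L, l ^ d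

/-- The Waring rank of a form `f` of degree `d`: the least size of a Waring decomposition of `f`
(with the value `0` if there is no decomposition at all). -/
noncomputable def waringRank {n : ℕ} (d : ℕ) (f : MvPolynomial (Fin n) ℂ) : ℕ :=
  sInf {r : ℕ | ∃ L : Finset (MvPolynomial (Fin n) ℂ), IsWaringDecomposition d f L ∧ L.card = r}

/-- `p_k(s)`: the number of partitions of `s` into exactly `k` (positive) parts. -/
def numPartitions (k s : ℕ) : ℕ :=
  (Finset.univ.filter (fun p : Nat.Partition s => p.parts.card = k)).card

/-! The form q_n^s contains only even monomials x^{2a} with |a| = s. If its coefficients are divided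
by multinomials, summing (Σ ± c_i x_i)^{2s} over signs, up to a global sign, gives a multiple of the
form with coefficients a ↦ ∏ t_i^{a_i}, t_i = c_i². If t lives on K, this costs 2^{|K|-1} powers
(`isSumOfPowers_evenForm_prod_pow`). Taking t_i to be powers of distinct primes makes these
functions the powers of one injective function of a. Lagrange interpolation then realises any
coefficients on the exponents of support K, with at most |K|! p_{|K|}(s) sign orbits
(`exists_interpolation`). The error lies on smaller supports, so one descends on support size. On
supports of size s and s-1 the coefficients of q_n^s are constant: the exponents are all 1, or one 2
and otherwise 1. There a single orbit per K suffices (`isSumOfPowers_evenForm_layer`), which gives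
the leading terms. -/

/-- `f` is the sum of the `d`-th powers of at most `r` linear forms, repetitions allowed. -/
def IsSumOfPowers {n : ℕ} (d : ℕ) (f : MvPolynomial (Fin n) ℂ) (r : ℕ) : Prop :=
  ∃ M : Multiset (MvPolynomial (Fin n) ℂ),
    (∀ l ∈ M, l.IsHomogeneous 1) ∧ M.card ≤ r ∧ f = (M.map (· ^ d)).sum

namespace IsSumOfPowers

variable {n d : ℕ} {f g : MvPolynomial (Fin n) ℂ} {r r' : ℕ}

lemma zero : IsSumOfPowers d (0 : MvPolynomial (Fin n) ℂ) r := ⟨0, by simp⟩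

lemma mono (h : IsSumOfPowers d f r) (hr : r ≤ r') : IsSumOfPowers d f r' := by
  obtain ⟨M, h1, h2, h3⟩ := h
  exact ⟨M, h1, h2.trans hr, h3⟩

lemma add (hf : IsSumOfPowers d f r) (hg : IsSumOfPowers d g r') :
    IsSumOfPowers d (f + g) (r + r') := by
  obtain ⟨M, h1, h2, h3⟩ := hf
  obtain ⟨N, k1, k2, k3⟩ := hg
  refine ⟨M + N, ?_, ?_, ?_⟩
  · intro l hl
    rcases Multiset.mem_add.1 hl with hl | hl
    exacts [h1 l hl, k1 l hl]
  · rw [Multiset.card_add]; exact add_le_add h2 k2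
  · rw [Multiset.map_add, Multiset.sum_add, ← h3, ← k3]

lemma sum {ι : Type*} (S : Finset ι) (F : ι → MvPolynomial (Fin n) ℂ) (r : ℕ)
    (h : ∀ i ∈ S, IsSumOfPowers d (F i) r) : IsSumOfPowers d (∑ i ∈ S, F i) (S.card * r) := by
  classical
  induction S using Finset.induction_on with
  | empty => simpa using zero
  | insert a S ha ih =>
    rw [Finset.sum_insert ha, Finset.card_insert_of_notMem ha, add_mul, one_mul, add_comm _ r]
    exact (h a (Finset.mem_insert_self a S)).add
      (ih fun i hi => h i (Finset.mem_insert_of_mem hi))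

lemma pow {l : MvPolynomial (Fin n) ℂ} (hl : l.IsHomogeneous 1) : IsSumOfPowers d (l ^ d) 1 :=
  ⟨{l}, by simpa using hl, by simp, by simp⟩

lemma C_mul (hd : d ≠ 0) (c : ℂ) (hf : IsSumOfPowers d f r) :
    IsSumOfPowers d (MvPolynomial.C c * f) r := by
  obtain ⟨M, h1, h2, h3⟩ := hf
  obtain ⟨z, hz⟩ := IsAlgClosed.exists_pow_nat_eq c (Nat.pos_of_ne_zero hd)
  refine ⟨M.map (MvPolynomial.C z * ·), ?_, by simpa using h2, ?_⟩
  · intro l hl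
    obtain ⟨m, hm, rfl⟩ := Multiset.mem_map.1 hl
    simpa using (MvPolynomial.isHomogeneous_C (Fin n) z).mul (h1 m hm)
  · rw [h3, Multiset.map_map, ← Multiset.sum_map_mul_left]
    simp only [Function.comp_def, mul_pow, ← map_pow, hz]

/-- Equal linear forms are merged by rescaling. -/
lemma exists_isWaringDecomposition (hd : d ≠ 0) (hf : IsSumOfPowers d f r) :
    ∃ L : Finset (MvPolynomial (Fin n) ℂ), IsWaringDecomposition d f L ∧ L.card ≤ r := by
  induction r using Nat.strong_induction_on with
  | _ r ih =>
    obtain ⟨M, h1, h2, h3⟩ := hf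
    by_cases hM : M.Nodup
    · exact ⟨(⟨M, hM⟩ : Finset (MvPolynomial (Fin n) ℂ)), ⟨h1, h3⟩, h2⟩
    · rw [Multiset.nodup_iff_ne_cons_cons] at hM
      push Not at hM
      obtain ⟨l, N, rfl⟩ := hM
      simp only [Multiset.card_cons] at h2
      have hN : IsSumOfPowers d (N.map (· ^ d)).sum (Multiset.card N) :=
        ⟨N, fun m hm => h1 m (by simp [hm]), le_rfl, rfl⟩
      have hl : IsSumOfPowers d (MvPolynomial.C 2 * l ^ d) 1 :=
        (pow (h1 l (by simp))).C_mul hd 2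
      have h4 : IsSumOfPowers d f (1 + Multiset.card N) := by
        convert! hl.add hN using 1
        rw [h3]
        simp only [Multiset.map_cons, Multiset.sum_cons, map_ofNat]
        ring
      obtain ⟨L, hL, hc⟩ := ih (1 + Multiset.card N) (by omega) h4
      exact ⟨L, hL, by omega⟩

lemma waringRank_le (hd : d ≠ 0) (hf : IsSumOfPowers d f r) : waringRank d f ≤ r := by
  obtain ⟨L, hL, hc⟩ := hf.exists_isWaringDecomposition hd
  unfold waringRank
  exact le_trans (Nat.sInf_le (by exact ⟨L, hL, rfl⟩)) hc

end IsSumOfPowers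

/-! ### Even forms and sums over signs -/

/-- The form of degree `2 * s` in the even monomials, with coefficients relative to the
multinomial ones. -/
noncomputable def evenForm {n : ℕ} (s : ℕ) : ((Fin n → ℕ) → ℂ) →ₗ[ℂ] MvPolynomial (Fin n) ℂ where
  toFun u := ∑ a ∈ Finset.piAntidiag Finset.univ s,
    MvPolynomial.C (Nat.multinomial Finset.univ (2 • a) * u a) *
      ∏ i, MvPolynomial.X i ^ (2 • a) i
  map_add' u v := by
    simp only [Pi.add_apply, mul_add, map_add, add_mul, Finset.sum_add_distrib]
  map_smul' c u := by
    simp only [Pi.smul_apply, smul_eq_mul, RingHom.id_apply, MvPolynomial.smul_eq_C_mul,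
      Finset.mul_sum, map_mul]
    refine Finset.sum_congr rfl fun a _ => ?_
    ring

lemma evenForm_apply {n : ℕ} (s : ℕ) (u : (Fin n → ℕ) → ℂ) :
    evenForm s u = ∑ a ∈ Finset.piAntidiag Finset.univ s,
      MvPolynomial.C (Nat.multinomial Finset.univ (2 • a) * u a) *
        ∏ i, MvPolynomial.X i ^ (2 • a) i := rfl

lemma evenForm_congr {n s : ℕ} {u v : (Fin n → ℕ) → ℂ}
    (h : ∀ a ∈ Finset.piAntidiag Finset.univ s, u a = v a) : evenForm s u = evenForm s v := by
  rw [evenForm_apply, evenForm_apply]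
  exact Finset.sum_congr rfl fun a ha => by rw [h a ha]

lemma quadricForm_pow_eq_evenForm (n s : ℕ) :
    quadricForm n ^ s = evenForm s fun a =>
      (Nat.multinomial Finset.univ a : ℂ) / Nat.multinomial Finset.univ (2 • a) := by
  rw [quadricForm, Finset.sum_pow_eq_sum_piAntidiag, evenForm_apply]
  refine Finset.sum_congr rfl fun a _ => ?_
  rw [mul_div_cancel₀ _ (Nat.cast_ne_zero.2 (Nat.multinomial_pos _ _).ne')]
  simp [← pow_mul]

/-- Summing over a sign kills odd exponents. The sign at `i₀` can stay fixed because the total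
degree is even. -/
lemma sum_sign_prod {n s : ℕ} (c : Fin n → ℂ) (K : Finset (Fin n)) (i₀ : Fin n)
    (hc : ∀ i, i ∉ K → c i = 0) (b : Fin n → ℕ) (hb : ∑ i, b i = 2 * s) :
    ∑ J ∈ (K.erase i₀).powerset, ∏ i, ((if i ∈ J then (-1 : ℂ) else 1) * c i) ^ b i =
      if ∀ i, 2 ∣ b i then 2 ^ (K.erase i₀).card * ∏ i, c i ^ b i else 0 := by
  have h1 : ∀ J : Finset (Fin n), ∏ i, ((if i ∈ J then (-1 : ℂ) else 1) * c i) ^ b i =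
      (∏ i ∈ J, (-1 : ℂ) ^ b i) * ∏ i, c i ^ b i := fun J => by
    simp only [mul_pow, Finset.prod_mul_distrib, ite_pow, one_pow]
    rw [Finset.prod_ite_mem, Finset.univ_inter]
  simp only [h1]
  rw [← Finset.sum_mul, ← Finset.prod_one_add]
  split_ifs with h
  · congr 1
    rw [Finset.prod_congr rfl (g := fun _ => (2 : ℂ)), Finset.prod_const]
    intro i _
    rw [(even_iff_two_dvd.2 (h i)).neg_one_pow]; norm_num
  · push Not at h
    obtain ⟨j, hj⟩ := h
    -- Were `i₀` the only index with odd exponent, the total degree would be odd.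
    obtain ⟨j, hj, hji⟩ : ∃ j, ¬ 2 ∣ b j ∧ j ≠ i₀ := by
      by_contra! hcon
      have hji : j = i₀ := hcon j hj
      have : 2 ∣ ∑ i ∈ Finset.univ.erase j, b i := Finset.dvd_sum fun i hi => by
        by_contra h2
        exact Finset.ne_of_mem_erase hi ((hcon i h2).trans hji.symm)
      have h3 := Finset.add_sum_erase Finset.univ b (Finset.mem_univ j)
      omega
    by_cases hK : j ∈ K
    · rw [Finset.prod_eq_zero (Finset.mem_erase.2 ⟨hji, hK⟩), zero_mul]
      rw [(Nat.not_even_iff_odd.1 (by rwa [even_iff_two_dvd])).neg_one_pow]; norm_num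
    · rw [Finset.prod_eq_zero (f := fun i => c i ^ b i) (Finset.mem_univ j), mul_zero]
      rw [hc j hK, zero_pow]
      rintro h0
      simp [h0] at hj

lemma sum_sign_pow_eq_evenForm {n : ℕ} (s : ℕ) (c : Fin n → ℂ) (K : Finset (Fin n)) (i₀ : Fin n)
    (hc : ∀ i, i ∉ K → c i = 0) :
    ∑ J ∈ (K.erase i₀).powerset,
      (∑ i, MvPolynomial.C ((if i ∈ J then (-1 : ℂ) else 1) * c i) * MvPolynomial.X i) ^ (2 * s) =
    MvPolynomial.C (2 ^ (K.erase i₀).card) *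
      evenForm s fun a => ∏ i, (c i ^ 2) ^ a i := by
  have h1 : ∀ J : Finset (Fin n), (∑ i, MvPolynomial.C ((if i ∈ J then (-1 : ℂ) else 1) * c i) *
      MvPolynomial.X i) ^ (2 * s) = ∑ b ∈ Finset.piAntidiag Finset.univ (2 * s),
        MvPolynomial.C (∏ i, ((if i ∈ J then (-1 : ℂ) else 1) * c i) ^ b i) *
          (MvPolynomial.C (Nat.multinomial Finset.univ b : ℂ) *
            ∏ i, MvPolynomial.X i ^ b i) := fun J => by
    rw [Finset.sum_pow_eq_sum_piAntidiag]
    refine Finset.sum_congr rfl fun b _ => ?_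
    simp only [mul_pow _ (MvPolynomial.X _), Finset.prod_mul_distrib, map_prod, map_pow,
      map_natCast]
    ring
  simp only [h1]
  rw [Finset.sum_comm]
  simp only [← Finset.sum_mul, ← map_sum]
  rw [Finset.sum_congr rfl fun b hb => by
    rw [sum_sign_prod (s := s) c K i₀ hc b (by simpa using hb)]]
  simp only [apply_ite MvPolynomial.C, map_zero, ite_mul, zero_mul]
  have hmap : {b ∈ Finset.piAntidiag (Finset.univ : Finset (Fin n)) (2 * s) | ∀ i, 2 ∣ b i} =
      (Finset.piAntidiag Finset.univ s).map ⟨(2 • ·), nsmul_right_injective two_ne_zero⟩ := by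
    rw [Finset.map_nsmul_piAntidiag_univ]
    · congr
    · exact two_ne_zero
  rw [← Finset.sum_filter, hmap, Finset.sum_map, evenForm_apply, Finset.mul_sum]
  refine Finset.sum_congr rfl fun a _ => ?_
  simp only [Function.Embedding.coeFn_mk, Pi.smul_apply, smul_eq_mul, pow_mul, map_mul]
  ring

lemma isSumOfPowers_evenForm_prod_pow {n s : ℕ} (hs : s ≠ 0) (t : Fin n → ℂ)
    (K : Finset (Fin n)) (hK : K.Nonempty) (ht : ∀ i, i ∉ K → t i = 0) :
    IsSumOfPowers (2 * s) (evenForm s fun a => ∏ i, t i ^ a i) (2 ^ (K.card - 1)) := by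
  obtain ⟨i₀, hi₀⟩ := hK
  choose c hc using fun i => IsAlgClosed.exists_pow_nat_eq (t i) two_pos
  have hcard := Finset.card_erase_of_mem hi₀
  have h := sum_sign_pow_eq_evenForm s c K i₀ fun i hi => by
    have := hc i
    rw [ht i hi] at this
    exact pow_eq_zero_iff two_ne_zero |>.1 this
  simp only [hc] at h
  have h2 : IsSumOfPowers (2 * s) (MvPolynomial.C (2 ^ (K.erase i₀).card) *
      evenForm s fun a => ∏ i, t i ^ a i) (2 ^ (K.card - 1)) := by
    rw [← h, ← hcard, ← Finset.card_powerset, ← mul_one (Finset.card _)]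
    refine IsSumOfPowers.sum _ _ _ fun J _ => IsSumOfPowers.pow ?_
    refine MvPolynomial.IsHomogeneous.sum _ _ _ fun i _ => ?_
    simpa using (MvPolynomial.isHomogeneous_C (Fin n) _).mul (MvPolynomial.isHomogeneous_X ℂ i)
  have h3 := h2.C_mul (by omega) (2 ^ (K.erase i₀).card : ℂ)⁻¹
  rwa [← mul_assoc, ← map_mul, inv_mul_cancel₀ (pow_ne_zero _ two_ne_zero), map_one, one_mul] at h3

/-! ### Interpolation on a fixed support -/

/-- The exponents of degree `s` whose support is exactly `K`. -/
def exponentsWithSupport {n : ℕ} (s : ℕ) (K : Finset (Fin n)) : Finset (Fin n → ℕ) :=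
  {a ∈ Finset.piAntidiag Finset.univ s | Finset.univ.filter (a · ≠ 0) = K}

/-- Read along `K`, such an exponent is an ordering of a partition of `s` into `K.card` parts. -/
lemma card_exponentsWithSupport_le {n : ℕ} (s : ℕ) (K : Finset (Fin n)) :
    (exponentsWithSupport s K).card ≤ K.card.factorial * numPartitions K.card s := by
  classical
  rw [numPartitions, mul_comm]
  set P := Finset.univ.filter (fun p : Nat.Partition s => p.parts.card = K.card)
  set T : Finset (List ℕ) := P.biUnion fun p => p.parts.toList.permutations.toFinset with hT
  have hle : T.card ≤ P.card * K.card.factorial := by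
    refine Finset.card_biUnion_le_card_mul _ _ _ fun p hp => ?_
    refine (List.toFinset_card_le _).trans ?_
    rw [List.length_permutations, Multiset.length_toList, (Finset.mem_filter.1 hp).2]
  refine le_trans ?_ hle
  refine Finset.card_le_card_of_injOn (fun a => K.toList.map a) ?_ ?_
  · intro a ha
    obtain ⟨ha, haK⟩ := Finset.mem_filter.1 ha
    obtain ⟨ha, -⟩ := Finset.mem_piAntidiag.1 ha
    have hcoe : ((K.toList.map a : List ℕ) : Multiset ℕ) = K.val.map a := by
      rw [← Multiset.map_coe, Finset.coe_toList]
    simp only [hT, Finset.coe_biUnion, Set.mem_iUnion]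
    refine ⟨⟨K.val.map a, ?_, ?_⟩, ?_, ?_⟩
    · intro i hi
      obtain ⟨j, hj, rfl⟩ := Multiset.mem_map.1 hi
      rw [← haK] at hj
      exact Nat.pos_of_ne_zero (Finset.mem_filter.1 (Finset.mem_def.2 hj)).2
    · change ∑ i ∈ K, a i = s
      rw [← haK, Finset.sum_filter_ne_zero, ← ha]
    · simp [P]
    · simp only [Finset.mem_coe, List.mem_toFinset, List.mem_permutations]
      rw [← Multiset.coe_eq_coe, hcoe, Multiset.coe_toList]
  · intro a ha b hb hab
    have ha' := (Finset.mem_filter.1 ha).2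
    have hb' := (Finset.mem_filter.1 hb).2
    funext i
    by_cases hi : i ∈ K
    · exact List.map_eq_map_iff.1 hab i (Finset.mem_toList.2 hi)
    · have h1 := hi
      rw [← ha'] at h1
      rw [← hb'] at hi
      simp only [Finset.mem_filter, Finset.mem_univ, true_and, not_not] at h1 hi
      rw [h1, hi]

/-- Unique factorization; this supplies distinct interpolation nodes. -/
lemma prod_nth_prime_pow_injective (n : ℕ) :
    Function.Injective fun a : Fin n → ℕ => ∏ i : Fin n, Nat.nth Nat.Prime i ^ a i := by
  intro a b hab
  have key : ∀ (c : Fin n → ℕ) (j : Fin n),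
      (∏ i : Fin n, Nat.nth Nat.Prime i ^ c i).factorization (Nat.nth Nat.Prime j) = c j := by
    intro c j
    rw [Nat.factorization_prod fun (i : Fin n) _ =>
        pow_ne_zero (c i) (Nat.prime_nth_prime i).ne_zero,
      Finset.sum_apply']
    rw [Finset.sum_eq_single j]
    · simp
    · intro i _ hij
      have : Nat.nth Nat.Prime i ≠ Nat.nth Nat.Prime j := fun h =>
        hij (Fin.ext (Nat.nth_injective Nat.infinite_setOfPred_prime h))
      simp [this]
    · simp
  funext j
  rw [← key a j, ← key b j]
  exact congrArg (fun m => Nat.factorization m (Nat.nth Nat.Prime j)) hab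

lemma prod_ite_mem_pow_eq_zero {n : ℕ} {K : Finset (Fin n)} {a : Fin n → ℕ}
    (ha : ¬ Finset.univ.filter (a · ≠ 0) ⊆ K) (t : Fin n → ℂ) :
    ∏ i, (if i ∈ K then t i else 0) ^ a i = 0 := by
  obtain ⟨i, hi, hiK⟩ := Finset.not_subset.1 ha
  refine Finset.prod_eq_zero (Finset.mem_univ i) ?_
  rw [if_neg hiK, zero_pow (Finset.mem_filter.1 hi).2]

/-- A coefficient function prescribed on the exponents with support `K` extends by zero outside
of the exponents with support inside `K`, at the cost of one orbit of signs for each exponent. -/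
lemma exists_interpolation {n s : ℕ} (hs : s ≠ 0) (K : Finset (Fin n)) (hK : K.Nonempty)
    (u : (Fin n → ℕ) → ℂ) :
    ∃ w : (Fin n → ℕ) → ℂ, (∀ a ∈ exponentsWithSupport s K, w a = u a) ∧
      (∀ a, ¬ Finset.univ.filter (a · ≠ 0) ⊆ K → w a = 0) ∧
      IsSumOfPowers (2 * s) (evenForm s w)
        ((exponentsWithSupport s K).card * 2 ^ (K.card - 1)) := by
  classical
  set A := exponentsWithSupport s K with hA
  set v : (Fin n → ℕ) → ℂ := fun a => ((∏ i : Fin n, Nat.nth Nat.Prime i ^ a i : ℕ) : ℂ) with hv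
  have hinj : Set.InjOn v A := fun a _ b _ hab =>
    prod_nth_prime_pow_injective n (Nat.cast_injective hab)
  set p := Lagrange.interpolate A v u with hp
  have hdeg : p.degree < A.card := Lagrange.degree_interpolate_lt u hinj
  -- On exponents with support `K`, the point `t j` yields the function `v ^ j`, so the coefficients
  -- of `p` are the weights needed.
  set t : ℕ → Fin n → ℂ := fun j i => if i ∈ K then ((Nat.nth Nat.Prime i : ℂ) ^ j) else 0
  refine ⟨∑ j ∈ Finset.range A.card, p.coeff j • fun a => ∏ i, t j i ^ a i, ?_, ?_, ?_⟩
  · intro a ha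
    have haK : Finset.univ.filter (a · ≠ 0) = K := (Finset.mem_filter.1 ha).2
    have hnat : p.natDegree < A.card := by
      by_cases h0 : p = 0
      · rw [h0, Polynomial.natDegree_zero]
        exact Finset.card_pos.2 ⟨a, ha⟩
      · exact (Polynomial.natDegree_lt_iff_degree_lt h0).2 hdeg
    rw [← Lagrange.eval_interpolate_at_node u hinj ha, ← hp,
      Polynomial.eval_eq_sum_range' hnat, Finset.sum_apply]
    refine Finset.sum_congr rfl fun j _ => ?_
    simp only [Pi.smul_apply, smul_eq_mul, hv]
    congr 1
    rw [Nat.cast_prod, ← Finset.prod_pow]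
    refine Finset.prod_congr rfl fun i _ => ?_
    by_cases hi : i ∈ K
    · simp only [t, if_pos hi, Nat.cast_pow, ← pow_mul, mul_comm]
    · have : a i = 0 := by
        rw [← haK] at hi
        simpa using hi
      simp [this]
  · intro a ha
    rw [Finset.sum_apply]
    refine Finset.sum_eq_zero fun j _ => ?_
    simp only [Pi.smul_apply, t, prod_ite_mem_pow_eq_zero ha, smul_zero]
  · rw [map_sum]
    conv => arg 3; rw [← Finset.card_range A.card]
    refine IsSumOfPowers.sum _ _ _ fun j _ => ?_
    rw [map_smul, MvPolynomial.smul_eq_C_mul]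
    exact (isSumOfPowers_evenForm_prod_pow hs _ K hK fun i hi => if_neg hi).C_mul (by omega) _

/-! ### Descent on the size of the support -/

/-- Summing over all `K` of size `m` functions supported on the exponents with support in `K`,
only the term of the support remains at an exponent with support of size at least `m`. -/
lemma sum_powersetCard_eq_ite {n m : ℕ} (w : Finset (Fin n) → (Fin n → ℕ) → ℂ)
    (hw : ∀ K a, ¬ Finset.univ.filter (a · ≠ 0) ⊆ K → w K a = 0) (a : Fin n → ℕ)
    (ha : m ≤ (Finset.univ.filter (a · ≠ 0)).card) :
    ∑ K ∈ Finset.powersetCard m Finset.univ, w K a =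
      if (Finset.univ.filter (a · ≠ 0)).card = m then w (Finset.univ.filter (a · ≠ 0)) a else 0 := by
  have h : ∀ K ∈ Finset.powersetCard m Finset.univ, K ≠ Finset.univ.filter (a · ≠ 0) →
      w K a = 0 := by
    intro K hK hne
    refine hw K a fun hsub => hne ?_
    refine (Finset.eq_of_subset_of_card_le hsub ?_).symm
    rw [(Finset.mem_powersetCard.1 hK).2]
    exact ha
  split_ifs with hm
  · exact Finset.sum_eq_single _ h fun hn =>
      absurd (Finset.mem_powersetCard.2 ⟨Finset.subset_univ _, hm⟩) hn
  · refine Finset.sum_eq_zero fun K hK => h K hK ?_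
    rintro rfl
    exact hm (Finset.mem_powersetCard.1 hK).2

/-- Interpolating on every `K` of the top size clears that size: the functions for different `K` do
not interfere there, and what they add lies on smaller supports. -/
lemma isSumOfPowers_evenForm_of_card_support_le {n s : ℕ} (hs : s ≠ 0) (m : ℕ) :
    ∀ u : (Fin n → ℕ) → ℂ, (∀ a ∈ Finset.piAntidiag Finset.univ s,
      m < (Finset.univ.filter (a · ≠ 0)).card → u a = 0) →
    IsSumOfPowers (2 * s) (evenForm s u) (∑ k ∈ Finset.Icc 1 m,
      2 ^ (k - 1) * k.factorial * numPartitions k s * n.choose k) := by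
  induction m with
  | zero =>
    intro u hu
    have : evenForm s u = 0 := by
      rw [evenForm_congr (v := 0), map_zero]
      intro a ha
      refine hu a ha (Finset.card_pos.2 (Finset.nonempty_iff_ne_empty.2 fun h => hs ?_))
      rw [← (Finset.mem_piAntidiag.1 ha).1]
      refine Finset.sum_eq_zero fun i _ => ?_
      by_contra h0
      have hi := Finset.filter_eq_empty_iff.1 h (Finset.mem_univ i)
      exact hi h0
    rw [this]
    exact IsSumOfPowers.zero
  | succ m ih =>
    intro u hu
    have hex : ∀ K : Finset (Fin n), ∃ w : (Fin n → ℕ) → ℂ,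
        (∀ a, ¬ Finset.univ.filter (a · ≠ 0) ⊆ K → w a = 0) ∧ (K.Nonempty →
        (∀ a ∈ exponentsWithSupport s K, w a = u a) ∧ IsSumOfPowers (2 * s) (evenForm s w)
        ((exponentsWithSupport s K).card * 2 ^ (K.card - 1))) := by
      intro K
      by_cases hK : K.Nonempty
      · obtain ⟨w, h1, h2, h3⟩ := exists_interpolation hs K hK u
        exact ⟨w, h2, fun _ => ⟨h1, h3⟩⟩
      · exact ⟨0, fun _ _ => rfl, fun h => absurd h hK⟩
    choose w hw0 hw using hex
    set W := ∑ K ∈ Finset.powersetCard (m + 1) (Finset.univ : Finset (Fin n)), w K with hW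
    have hrest := ih (u - W) fun a ha hcard => by
      rw [hW, Pi.sub_apply, Finset.sum_apply, sum_powersetCard_eq_ite w hw0 a hcard]
      split_ifs with h
      · rw [(hw _ (Finset.card_pos.1 (by omega))).1 a (Finset.mem_filter.2 ⟨ha, rfl⟩), sub_self]
      · rw [hu a ha (by omega), sub_zero]
    have htop : IsSumOfPowers (2 * s) (evenForm s W)
        (n.choose (m + 1) * (2 ^ m * ((m + 1).factorial * numPartitions (m + 1) s))) := by
      rw [hW, map_sum]
      convert! IsSumOfPowers.sum _ _ _ fun K hK => ?_ using 1
      · rw [Finset.card_powersetCard, Finset.card_univ, Fintype.card_fin]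
      · have hc := (Finset.mem_powersetCard.1 hK).2
        refine (hw K (Finset.card_pos.1 (by omega))).2.mono ?_
        rw [hc, mul_comm, ← hc]
        exact Nat.mul_le_mul (by simp [hc]) (card_exponentsWithSupport_le s K)
    rw [Finset.sum_Icc_succ_top (by omega), ← sub_add_cancel u W, map_add]
    refine (hrest.add htop).mono (le_of_eq ?_)
    rw [Nat.add_sub_cancel]
    ring

/-! ### The two top support sizes -/

lemma prod_indicator_pow {n : ℕ} (K : Finset (Fin n)) (a : Fin n → ℕ) :
    ∏ i, (if i ∈ K then (1 : ℂ) else 0) ^ a i =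
      if Finset.univ.filter (a · ≠ 0) ⊆ K then 1 else 0 := by
  split_ifs with h
  · refine Finset.prod_eq_one fun i _ => ?_
    by_cases hi : a i = 0
    · simp [hi]
    · rw [if_pos (h (Finset.mem_filter.2 ⟨Finset.mem_univ i, hi⟩)), one_pow]
  · exact prod_ite_mem_pow_eq_zero h fun _ => 1

/-- The coefficient function which at `a` counts, with weight `v`, the sets of size `m` containing
the support of `a`. -/
noncomputable def layer {n : ℕ} (m : ℕ) (v : ℂ) (a : Fin n → ℕ) : ℂ :=
  ∑ K ∈ Finset.powersetCard m Finset.univ,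
    if Finset.univ.filter (a · ≠ 0) ⊆ K then v else 0

lemma layer_of_card_support_ge {n m : ℕ} (v : ℂ) (a : Fin n → ℕ)
    (ha : m ≤ (Finset.univ.filter (a · ≠ 0)).card) :
    layer m v a = if (Finset.univ.filter (a · ≠ 0)).card = m then v else 0 := by
  rw [layer, sum_powersetCard_eq_ite (fun K a => if Finset.univ.filter (a · ≠ 0) ⊆ K then v else 0)
    (fun K a h => if_neg h) a ha]
  simp

/-- The sets counted arise by adding one of the `n - m` points outside the support. This is the
error that a layer leaves one size below. -/
lemma layer_of_card_support_succ {n m : ℕ} (v : ℂ) (a : Fin n → ℕ)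
    (ha : (Finset.univ.filter (a · ≠ 0)).card = m) :
    layer (m + 1) v a = (n - m : ℕ) * v := by
  set S := Finset.univ.filter (a · ≠ 0) with hS
  have hset : (Finset.powersetCard (m + 1) Finset.univ).filter (S ⊆ ·) =
      Sᶜ.image (insert · S) := by
    ext K
    simp only [Finset.mem_filter, Finset.mem_powersetCard, Finset.subset_univ, true_and,
      Finset.mem_image, Finset.mem_compl]
    constructor
    · rintro ⟨hK, hSK⟩
      have hc : (K \ S).card = 1 := by
        rw [Finset.card_sdiff_of_subset hSK]
        omega
      obtain ⟨x, hx⟩ := Finset.card_eq_one.1 hc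
      refine ⟨x, (Finset.mem_sdiff.1 (hx ▸ Finset.mem_singleton_self x)).2, ?_⟩
      rw [Finset.insert_eq, ← hx, Finset.sdiff_union_of_subset hSK]
    · rintro ⟨x, hx, rfl⟩
      rw [Finset.card_insert_of_notMem hx, ha]
      exact ⟨rfl, Finset.subset_insert x S⟩
  have hcard : (Sᶜ.image (insert · S)).card = n - m := by
    rw [Finset.card_image_of_injOn, Finset.card_compl, Fintype.card_fin, ha]
    intro x hx y hy hxy
    have h : x ∈ insert y S := by
      have : insert x S = insert y S := hxy
      exact this ▸ Finset.mem_insert_self x S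
    exact (Finset.mem_insert.1 h).resolve_right (Finset.mem_compl.1 hx)
  rw [layer, ← hS, ← Finset.sum_filter, hset, Finset.sum_const, hcard, nsmul_eq_mul]

/-- Each `K` needs one sign orbit, that of its indicator vector. -/
lemma isSumOfPowers_evenForm_layer {n s m : ℕ} (hs : s ≠ 0) (hm : m ≠ 0) (v : ℂ) :
    IsSumOfPowers (2 * s) (evenForm s (layer (n := n) m v)) (n.choose m * 2 ^ (m - 1)) := by
  have h : layer (n := n) m v = ∑ K ∈ Finset.powersetCard m Finset.univ,
      v • fun a => ∏ i, (if i ∈ K then (1 : ℂ) else 0) ^ a i := by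
    funext a
    rw [layer, Finset.sum_apply]
    refine Finset.sum_congr rfl fun K _ => ?_
    rw [Pi.smul_apply, prod_indicator_pow]
    split_ifs <;> simp
  rw [h, map_sum]
  convert! IsSumOfPowers.sum _ _ _ fun K hK => ?_ using 1
  · rw [Finset.card_powersetCard, Finset.card_univ, Fintype.card_fin]
  · have hc := (Finset.mem_powersetCard.1 hK).2
    rw [map_smul, MvPolynomial.smul_eq_C_mul, ← hc]
    exact (isSumOfPowers_evenForm_prod_pow hs _ K (Finset.card_pos.1 (by omega))
      fun i hi => if_neg hi).C_mul (by omega) _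

lemma eq_one_of_sum_eq_card {ι : Type*} {S : Finset ι} {a : ι → ℕ} (ha : ∀ i ∈ S, 1 ≤ a i)
    (hsum : ∑ i ∈ S, a i = S.card) : ∀ i ∈ S, a i = 1 := by
  rw [Finset.card_eq_sum_ones] at hsum
  exact fun i hi => ((Finset.sum_eq_sum_iff_of_le ha).1 hsum.symm i hi).symm

lemma prod_eq_of_sum_eq_card_add_one {ι : Type*} [DecidableEq ι] {S : Finset ι} {a : ι → ℕ}
    (ha : ∀ i ∈ S, 1 ≤ a i) (hsum : ∑ i ∈ S, a i = S.card + 1) (g : ℕ → ℂ) :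
    ∏ i ∈ S, g (a i) = g 2 * g 1 ^ (S.card - 1) := by
  obtain ⟨i, hi, hai⟩ : ∃ i ∈ S, 2 ≤ a i := by
    by_contra! h
    have : ∑ i ∈ S, a i ≤ ∑ i ∈ S, 1 := Finset.sum_le_sum fun i hi => by
      have := h i hi
      omega
    rw [← Finset.card_eq_sum_ones] at this
    omega
  have ha' : ∀ j ∈ S.erase i, 1 ≤ a j := fun j hj => ha j (Finset.mem_of_mem_erase hj)
  have hle : (S.erase i).card ≤ ∑ j ∈ S.erase i, a j := by
    rw [Finset.card_eq_sum_ones]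
    exact Finset.sum_le_sum ha'
  have hadd := Finset.add_sum_erase S a hi
  have hc := Finset.card_erase_add_one hi
  have hone := eq_one_of_sum_eq_card ha' (by omega)
  rw [← Finset.mul_prod_erase S _ hi, ← Finset.card_erase_of_mem hi]
  congr 1
  · congr 1
    omega
  · rw [Finset.prod_congr rfl fun j hj => by rw [hone j hj], Finset.prod_const]

/-- The coefficient is a product of one factor per exponent, so it depends only on the multiset of
nonzero exponents. -/
lemma multinomial_div_multinomial {n s : ℕ} {a : Fin n → ℕ}
    (ha : a ∈ Finset.piAntidiag Finset.univ s) :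
    (Nat.multinomial Finset.univ a : ℂ) / Nat.multinomial Finset.univ (2 • a) =
      s.factorial / (2 * s).factorial * ∏ i ∈ Finset.univ.filter (a · ≠ 0),
        ((2 * a i).factorial : ℂ) / (a i).factorial := by
  have hsum := (Finset.mem_piAntidiag.1 ha).1
  have h1 := Nat.multinomial_spec Finset.univ a
  have h2 := Nat.multinomial_spec Finset.univ (2 • a)
  simp only [Pi.smul_apply, smul_eq_mul, ← Finset.mul_sum, hsum] at h1 h2
  rw [Finset.prod_filter_of_ne, Finset.prod_div_distrib, ← h1, ← h2]
  · have e1 : (Nat.multinomial Finset.univ (2 • a) : ℂ) ≠ 0 :=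
      Nat.cast_ne_zero.2 (Nat.multinomial_pos _ _).ne'
    have e2 : (∏ i, ((a i).factorial : ℂ)) ≠ 0 :=
      Finset.prod_ne_zero_iff.2 fun i _ => Nat.cast_ne_zero.2 (Nat.factorial_ne_zero _)
    have e3 : (∏ i, ((2 * a i).factorial : ℂ)) ≠ 0 :=
      Finset.prod_ne_zero_iff.2 fun i _ => Nat.cast_ne_zero.2 (Nat.factorial_ne_zero _)
    push_cast
    field_simp
  · intro i _ hi h0
    simp [h0] at hi

lemma isSumOfPowers_quadricForm_pow_add_two (n s : ℕ) :
    IsSumOfPowers (2 * (s + 2)) (quadricForm n ^ (s + 2))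
      (n.choose (s + 2) * 2 ^ (s + 1) + n.choose (s + 1) * 2 ^ s +
        ∑ k ∈ Finset.Icc 1 s, 2 ^ (k - 1) * k.factorial * numPartitions k (s + 2) *
          n.choose k) := by
  rw [quadricForm_pow_eq_evenForm]
  set u : (Fin n → ℕ) → ℂ := fun a =>
    (Nat.multinomial Finset.univ a : ℂ) / Nat.multinomial Finset.univ (2 • a) with hu
  set g : ℕ → ℂ := fun k => ((2 * k).factorial : ℂ) / k.factorial
  set r : ℂ := (s + 2).factorial / (2 * (s + 2)).factorial
  -- `x` is the coefficient at exponents all 1 on their support; `y` is the one at a single 2 and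
  -- otherwise 1, corrected for the layer of weight `x`.
  set x : ℂ := r * g 1 ^ (s + 2)
  set y : ℂ := r * (g 2 * g 1 ^ s) - (n - (s + 1) : ℕ) * x
  have hmem : ∀ a : Fin n → ℕ, ∀ i ∈ Finset.univ.filter (a · ≠ 0), 1 ≤ a i := fun a i hi =>
    Nat.one_le_iff_ne_zero.2 (Finset.mem_filter.1 hi).2
  have hsum : ∀ a : Fin n → ℕ, a ∈ Finset.piAntidiag Finset.univ (s + 2) →
      ∑ i ∈ Finset.univ.filter (a · ≠ 0), a i = s + 2 := fun a ha => by
    rw [Finset.sum_filter_ne_zero]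
    exact (Finset.mem_piAntidiag.1 ha).1
  have hrest := isSumOfPowers_evenForm_of_card_support_le (n := n) (s := s + 2) (by omega) s
    (u - layer (s + 2) x - layer (s + 1) y) fun a ha hcard => by
      have hle : (Finset.univ.filter (a · ≠ 0)).card ≤ s + 2 := by
        rw [← hsum a ha, Finset.card_eq_sum_ones]
        exact Finset.sum_le_sum (hmem a)
      simp only [Pi.sub_apply, hu]
      rw [multinomial_div_multinomial ha, layer_of_card_support_ge y a hcard]
      obtain h | h : (Finset.univ.filter (a · ≠ 0)).card = s + 2 ∨
          (Finset.univ.filter (a · ≠ 0)).card = s + 1 := by omega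
      · have hone := eq_one_of_sum_eq_card (hmem a) ((hsum a ha).trans h.symm)
        rw [layer_of_card_support_ge x a h.ge, if_pos h, if_neg (by omega),
          Finset.prod_congr rfl (g := fun _ => g 1) fun i hi => by rw [hone i hi],
          Finset.prod_const, h]
        ring
      · rw [layer_of_card_support_succ x a h, if_pos h,
          prod_eq_of_sum_eq_card_add_one (hmem a) (by rw [hsum a ha, h]) g, h]
        simp only [y, Nat.add_sub_cancel]
        ring
  have hx := isSumOfPowers_evenForm_layer (n := n) (s := s + 2) (m := s + 2) (by omega)
    (by omega) x
  have hy := isSumOfPowers_evenForm_layer (n := n) (s := s + 2) (m := s + 1) (by omega)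
    (by omega) y
  have := (hx.add hy).add hrest
  rw [← map_add, ← map_add] at this
  convert! this using 2
  abel

/-! ### The numerical bound and its growth -/

/-- The bound for the Waring rank of `quadricForm n ^ s`, rounded down for `s = 1`. -/
def quadricRankBound (n s : ℕ) : ℕ :=
  2 ^ (s - 1) * n.choose s + (if 2 ≤ s then 2 ^ (s - 2) * n.choose (s - 1) else 0) +
    ∑ k ∈ Finset.Icc 1 (s - 2), 2 ^ (k - 1) * k.factorial * numPartitions k s * n.choose k

lemma isSumOfPowers_quadricForm_pow (n : ℕ) {s : ℕ} (hs : 1 ≤ s) :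
    IsSumOfPowers (2 * s) (quadricForm n ^ s) (quadricRankBound n s) := by
  obtain rfl | hs := hs.eq_or_lt
  · have h := IsSumOfPowers.sum (d := 2) (Finset.univ : Finset (Fin n))
      (fun i => MvPolynomial.X i ^ 2) 1
      fun i _ => IsSumOfPowers.pow (MvPolynomial.isHomogeneous_X ℂ i)
    simpa [quadricRankBound, quadricForm] using h
  · obtain ⟨s, rfl⟩ : ∃ m, s = m + 2 := Nat.exists_eq_add_of_le' hs
    have h2 : 2 ≤ s + 2 := hs
    convert isSumOfPowers_quadricForm_pow_add_two n s using 1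
    simp only [quadricRankBound, Nat.add_sub_cancel, if_pos h2,
      show s + 2 - 1 = s + 1 by omega]
    ring

lemma quadricRankBound_le (n s : ℕ) (hs : 1 ≤ s) :
    (quadricRankBound n s : ℝ) ≤
      (2 : ℝ) ^ ((s : ℤ) - 1) * (n.choose s : ℝ)
          + (2 : ℝ) ^ ((s : ℤ) - 2) * (n.choose (s - 1) : ℝ)
          + ∑ k ∈ Finset.Icc 1 (s - 2),
              (2 : ℝ) ^ (k - 1) * (k.factorial : ℝ) * (numPartitions k s : ℝ)
                * (n.choose k : ℝ) := by
  rw [quadricRankBound]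
  push_cast
  refine add_le_add (add_le_add ?_ ?_) le_rfl
  · rw [show (s : ℤ) - 1 = ((s - 1 : ℕ) : ℤ) by omega, zpow_natCast]
  · split_ifs with h
    · rw [show (s : ℤ) - 2 = ((s - 2 : ℕ) : ℤ) by omega, zpow_natCast]
    -- For `s = 1` the real bound has a spare 1/2.
    · positivity

lemma quadricRankBound_isBigO (s : ℕ) :
    (fun n : ℕ => (quadricRankBound n s : ℝ)) =O[atTop] fun n : ℕ => (n : ℝ) ^ s := by
  have hchoose : ∀ (c : ℝ) (k : ℕ), k ≤ s →
      (fun n : ℕ => c * (n.choose k : ℝ)) =O[atTop] fun n : ℕ => (n : ℝ) ^ s := by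
    intro c k hk
    refine IsBigO.const_mul_left (IsBigO.of_bound 1 ?_) c
    filter_upwards [eventually_ge_atTop 1] with n hn
    rw [one_mul, Real.norm_of_nonneg (by positivity), Real.norm_of_nonneg (by positivity)]
    exact_mod_cast (Nat.choose_le_pow n k).trans (Nat.pow_le_pow_right hn hk)
  simp only [quadricRankBound, Nat.cast_add, Nat.cast_sum, Nat.cast_mul]
  refine ((hchoose _ s le_rfl).add ?_).add (IsBigO.fun_sum fun k hk => hchoose _ k ?_)
  · split_ifs
    · simp only [Nat.cast_mul]
      exact hchoose _ _ (Nat.sub_le _ _)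
    · simp only [Nat.cast_zero]
      exact isBigO_zero _ _
  · have := (Finset.mem_Icc.1 hk).2
    omega

lemma waringRank_zero_one_le (n : ℕ) : waringRank 0 (1 : MvPolynomial (Fin n) ℂ) ≤ 1 := by
  refine Nat.sInf_le ?_
  -- In degree 0 the zero form serves, since `0 ^ 0 = 1`.
  refine ⟨{0}, ⟨fun l hl => ?_, by simp⟩, Finset.card_singleton 0⟩
  rw [Finset.mem_singleton.1 hl]
  exact MvPolynomial.isHomogeneous_zero _ _ _

theorem theorem1p1 :
    (∀ n s : ℕ, 1 ≤ s →
      (∃ L : Finset (MvPolynomial (Fin n) ℂ),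
        IsWaringDecomposition (2 * s) (quadricForm n ^ s) L) ∧
      (waringRank (2 * s) (quadricForm n ^ s) : ℝ) ≤
        (2 : ℝ) ^ ((s : ℤ) - 1) * (n.choose s : ℝ)
          + (2 : ℝ) ^ ((s : ℤ) - 2) * (n.choose (s - 1) : ℝ)
          + ∑ k ∈ Finset.Icc 1 (s - 2),
              (2 : ℝ) ^ (k - 1) * (k.factorial : ℝ) * (numPartitions k s : ℝ)
                * (n.choose k : ℝ)) ∧
    (∀ s : ℕ,
      (fun n : ℕ => (waringRank (2 * s) (quadricForm n ^ s) : ℝ)) =O[atTop]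
        fun n : ℕ => (n : ℝ) ^ s) := by
  refine ⟨fun n s hs => ⟨?_, ?_⟩, fun s => ?_⟩
  · obtain ⟨L, hL, -⟩ :=
      (isSumOfPowers_quadricForm_pow n hs).exists_isWaringDecomposition (by omega)
    exact ⟨L, hL⟩
  · refine le_trans (Nat.cast_le.2 ?_) (quadricRankBound_le n s hs)
    exact (isSumOfPowers_quadricForm_pow n hs).waringRank_le (by omega)
  · obtain rfl | hs := Nat.eq_zero_or_pos s
    · refine IsBigO.of_bound 1 (Eventually.of_forall fun n => ?_)
      simpa using waringRank_zero_one_le n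
    · refine IsBigO.trans (IsBigO.of_bound 1 (Eventually.of_forall fun n => ?_))
        (quadricRankBound_isBigO s)
      simpa using (isSumOfPowers_quadricForm_pow n hs).waringRank_le (by omega)
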